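/- Let $m\ge 2$ and $p\ge m$ be integers, and let $T=(t_i)_{i\in\mathbb{Z}}$ be a strictly increasing sequence of real knots with $t_i\to\pm\infty$ as $i\to\pm\infty$. Let $B_i$ be the B-spline of degree $m$ with support $[t_{i-m},t_{i+1}]$, normalized by $\sum_i B_i=1$, and let $M_i$ be the B-spline of degree $m-2$ with support $[t_{i-m+1},t_i]$, normalized by $\int M_i=1$. Write $\langle M_i,f\rangle=\int M_i(x)f(x)\,dx$, $\mu_i^{(2)}=\int x^2M_i(x)\,dx$, $\theta_i=\frac1m\sum_{r=1}^m t_{i+1-r}$ and $\theta_i^{(2)}=\binom m2^{-1}\sum_{1\le r<s\le m}t_{i+1-r}t_{i+1-s}$. For real coefficients $a_i(-p),a_i(0),a_i(p)$ ($i\in\mathbb Z$) consider the integral quasi-interpolant $$Gf=\sum_{i\in\mathbb Z}\bigl(a_i(-p)\langle M_{i-p},f\rangle+a_i(0)\langle M_i,f\rangle+a_i(p)\langle M_{i+p},f\rangle\bigr)B_i .$$ Then $G$ is exact on the space $\mathbb P_2$ of polynomials of degree at most $2$ (that is, $Gq=q$ for all $q\in\mathbb P_2$) if and only if, for every $i\in\mathbb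 Z$, $$a_i(-p)+a_i(0)+a_i(p)=1,$$ $$\theta_{i-p}a_i(-p)+\theta_ia_i(0)+\theta_{i+p}a_i(p)=\theta_i,$$ $$\mu_{i-p}^{(2)}a_i(-p)+\mu_i^{(2)}a_i(0)+\mu_{i+p}^{(2)}a_i(p)=\theta_i^{(2)}.$$ For every $i$ this system has exactly one solution $(a_i^*(-p),a_i^*(0),a_i^*(p))$. The resulting quasi-interpolant $G_p^*$ is exact on $\mathbb P_2$ and is bounded independently of $p$ and of the partition: its operator norm with respect to the infinity norm, $\|G_p^*\|_\infty=\sup\{\sup_{x}|G_p^*f(x)| : f\in L^\infty(\mathbb R),\ \|f\|_\infty\le1\}$, satisfies $$\|G_p^*\|_\infty\le 1+\tfrac14C(m),\qquad C(m)=\begin{cases}\dfrac{m^2(m+2)}{(m-1)^2}&\text{for } m \text{ even},\\[2mm]\dfrac{(m+1)^2}{m-1}&\text{for } m\text{ odd}.\end{cases}$$ -/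

import Mathlib

open MeasureTheory Filter
open scoped ENNReal

namespace SplineQI

/-- A partition of the real line: a strictly increasing bi-infinite sequence of knots
with `t i → ±∞` as `i → ±∞`. -/
structure IsPartition (t : ℤ → ℝ) : Prop where
  strictMono : StrictMono t
  tendsto_atTop : Tendsto t atTop atTop
  tendsto_atBot : Tendsto t atBot atBot

/-- Cox–de Boor recursion: the B-spline of degree `k`, supported in `[t j, t (j + k + 1)]`,
in the normalization in which the B-splines of a given degree form a partition of unity. -/
noncomputable def coxDeBoor (t : ℤ → ℝ) : ℕ → ℤ → ℝ → ℝ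
  | 0, j, x => (Set.Ico (t j) (t (j + 1))).indicator (fun _ => 1) x
  | k + 1, j, x =>
      (x - t j) / (t (j + k + 1) - t j) * coxDeBoor t k j x
        + (t (j + k + 2) - x) / (t (j + k + 2) - t (j + 1)) * coxDeBoor t k (j + 1) x

/-- `B_j`: the B-spline of degree `m` with support `[t (j - m), t (j + 1)]`. -/
noncomputable def bSpline (t : ℤ → ℝ) (m : ℕ) (j : ℤ) (x : ℝ) : ℝ :=
  coxDeBoor t m (j - m) x

/-- `M_j`: the B-spline of degree `m - 2` with support `[t (j - m + 1), t j]`,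
normalized to have integral one. -/
noncomputable def mSpline (t : ℤ → ℝ) (m : ℕ) (j : ℤ) (x : ℝ) : ℝ :=
  coxDeBoor t (m - 2) (j - m + 1) x / ∫ y, coxDeBoor t (m - 2) (j - m + 1) y

/-- `⟨M_j, f⟩ = ∫ M_j(x) f(x) dx`. -/
noncomputable def mean (t : ℤ → ℝ) (m : ℕ) (j : ℤ) (f : ℝ → ℝ) : ℝ :=
  ∫ x, mSpline t m j x * f x

/-- `μ_j^{(l)}`: the `l`-th moment of `M_j`. -/
noncomputable def moment (t : ℤ → ℝ) (m : ℕ) (j : ℤ) (l : ℕ) : ℝ :=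
  ∫ x, x ^ l * mSpline t m j x

/-- `θ_j^{(l)} = σ_l(T_j) / C(m, l)`, where `σ_l` is the `l`-th elementary symmetric function
and `T_j` consists of the `m` knots `t j, t (j - 1), …, t (j - m + 1)`. -/
noncomputable def theta (t : ℤ → ℝ) (m : ℕ) (j : ℤ) (l : ℕ) : ℝ :=
  (∑ s ∈ (Finset.range m).powersetCard l, ∏ r ∈ s, t (j - (r : ℤ))) / (m.choose l : ℝ)

/-- The coefficient functional
`f ↦ a 0 * ⟨M_{i-p}, f⟩ + a 1 * ⟨M_i, f⟩ + a 2 * ⟨M_{i+p}, f⟩`. -/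
noncomputable def coeffFunctional (t : ℤ → ℝ) (m p : ℕ) (a : Fin 3 → ℝ) (i : ℤ)
    (f : ℝ → ℝ) : ℝ :=
  a 0 * mean t m (i - p) f + a 1 * mean t m i f + a 2 * mean t m (i + p) f

/-- The integral quasi-interpolant `f ↦ ∑ᵢ λ_i(f) B_i` with coefficients `a i`.
At each point only finitely many terms of the sum are nonzero. -/
noncomputable def integralQI (t : ℤ → ℝ) (m p : ℕ) (a : ℤ → Fin 3 → ℝ)
    (f : ℝ → ℝ) (x : ℝ) : ℝ :=
  ∑' i : ℤ, coeffFunctional t m p (a i) i f * bSpline t m i x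

/-- The operator `G` reproduces all polynomials of degree at most two. -/
def ExactOnP2 (G : (ℝ → ℝ) → ℝ → ℝ) : Prop :=
  ∀ q : Polynomial ℝ, q.degree ≤ 2 → ∀ x : ℝ, G (fun y => q.eval y) x = q.eval x

/-- The linear system for the coefficients
`a 0 = a_i^*(-p)`, `a 1 = a_i^*(0)`, `a 2 = a_i^*(p)`. -/
def CoeffSystem (t : ℤ → ℝ) (m p : ℕ) (i : ℤ) (a : Fin 3 → ℝ) : Prop :=
  a 0 + a 1 + a 2 = 1 ∧
  theta t m (i - p) 1 * a 0 + theta t m i 1 * a 1 + theta t m (i + p) 1 * a 2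
    = theta t m i 1 ∧
  moment t m (i - p) 2 * a 0 + moment t m i 2 * a 1 + moment t m (i + p) 2 * a 2
    = theta t m i 2

/-- The infinity norm of an operator: the supremum of `sup_x |G f x|` over all
`f ∈ L^∞(ℝ)` with `‖f‖_∞ ≤ 1`. -/
noncomputable def infNorm (G : (ℝ → ℝ) → ℝ → ℝ) : ℝ≥0∞ :=
  ⨆ (f : ℝ → ℝ) (_ : AEStronglyMeasurable f volume) (_ : eLpNorm f ∞ volume ≤ 1),
    ⨆ x : ℝ, ‖G f x‖ₑ

/-- The constant `C(m)`. -/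
noncomputable def boundConst (m : ℕ) : ℝ :=
  if Even m then (m : ℝ) ^ 2 * ((m : ℝ) + 2) / ((m : ℝ) - 1) ^ 2
  else ((m : ℝ) + 1) ^ 2 / ((m : ℝ) - 1)

end SplineQI

namespace SplineQI

/-! Marsden's identity (`hasSum_knotEsymm_mul_coxDeBoor`) says that the B-spline coefficients of `x
^ l` are the `theta t m i l`, and B-spline coefficients are unique
(`eq_zero_of_hasSum_coxDeBoor_eq_zero`). Hence exactness on quadratics means that each coefficient
functional sends `1, x, x ^ 2` to `theta` of orders `0, 1, 2`. The moments of `M_i` turn these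
conditions into the linear system.

The moments are normalized complete symmetric functions of the same `m` knots
(`integral_pow_mul_coxDeBoor`). With `θ` the mean of these knots and `V` the sum of their squared
deviations (`knotSpread`), the second moment is `θ² + V/(m(m+1))`, while the target is `θ² -
V/(m(m-1))`. The system thus asks for three masses with total one, barycentre `θ` and a prescribed
second moment, smaller than that of the middle mass alone unless `V = 0`. The outer masses are
therefore nonpositive, and `exists_unique_masses` computes them.

Since `p ≥ m`, the three knot groups are disjoint, so the outer means lie beyond the extreme knots
of the middle group. Together with `knotSpread_le` this gives `V < m u w`, where `u, w` are the
distances from `θ` to the outer means. This makes the determinant positive and bounds the absolute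
sum of the coefficients by `1 + 4/(m-1)`, which is at most `1 + C(m)/4`. Nonnegativity and partition
of unity carry the bound over to the operator. -/

/-! ### Elementary symmetric functions of knots -/

/-- The elementary symmetric function of order `l` of the values `t r`, `r ∈ s`. -/
noncomputable def knotEsymm (t : ℤ → ℝ) (s : Finset ℤ) (l : ℕ) : ℝ :=
  ∑ u ∈ s.powersetCard l, ∏ r ∈ u, t r

theorem knotEsymm_zero (t : ℤ → ℝ) (s : Finset ℤ) : knotEsymm t s 0 = 1 := by
  simp [knotEsymm]

theorem knotEsymm_empty_succ (t : ℤ → ℝ) (l : ℕ) : knotEsymm t ∅ (l + 1) = 0 := by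
  rw [knotEsymm, Finset.powersetCard_eq_empty.2 (by simp), Finset.sum_empty]

theorem knotEsymm_insert (t : ℤ → ℝ) {s : Finset ℤ} {a : ℤ} (ha : a ∉ s) (l : ℕ) :
    knotEsymm t (insert a s) (l + 1) = knotEsymm t s (l + 1) + t a * knotEsymm t s l := by
  unfold knotEsymm
  rw [Finset.powersetCard_succ_insert ha, Finset.sum_union, Finset.sum_image, Finset.mul_sum]
  · congr 1
    refine Finset.sum_congr rfl fun u hu => ?_
    rw [Finset.prod_insert fun h => ha ((Finset.mem_powersetCard.1 hu).1 h)]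
  · intro u hu v hv huv
    have hu' : a ∉ u := fun h => ha ((Finset.mem_powersetCard.1 hu).1 h)
    have hv' : a ∉ v := fun h => ha ((Finset.mem_powersetCard.1 hv).1 h)
    rw [← Finset.erase_insert hu', ← Finset.erase_insert hv']
    exact congrArg (fun w => w.erase a) huv
  · rw [Finset.disjoint_left]
    intro u hu hu'
    obtain ⟨v, -, rfl⟩ := Finset.mem_image.1 hu'
    exact ha ((Finset.mem_powersetCard.1 hu).1 (Finset.mem_insert_self a v))

theorem knotEsymm_one (t : ℤ → ℝ) (s : Finset ℤ) : knotEsymm t s 1 = ∑ r ∈ s, t r := by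
  induction s using Finset.induction_on with
  | empty => simp [knotEsymm_empty_succ]
  | insert a s ha ih =>
    rw [knotEsymm_insert t ha, Finset.sum_insert ha, ih, knotEsymm_zero]
    ring

theorem two_mul_knotEsymm_two (t : ℤ → ℝ) (s : Finset ℤ) :
    2 * knotEsymm t s 2 = (∑ r ∈ s, t r) ^ 2 - ∑ r ∈ s, t r ^ 2 := by
  induction s using Finset.induction_on with
  | empty => simp [knotEsymm_empty_succ]
  | insert a s ha ih =>
    rw [knotEsymm_insert t ha, Finset.sum_insert ha, Finset.sum_insert ha, knotEsymm_one]
    linear_combination ih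

theorem theta_eq (t : ℤ → ℝ) (m : ℕ) (j : ℤ) (l : ℕ) :
    theta t m j l = knotEsymm t (Finset.Ioc (j - m) j) l / (m.choose l : ℝ) := by
  let e : ℕ ↪ ℤ := ⟨fun r => j - (r : ℤ), fun a b h => by simpa using h⟩
  have he : ∀ r, e r = j - (r : ℤ) := fun _ => rfl
  have hmap : Finset.Ioc (j - (m : ℤ)) j = (Finset.range m).map e := by
    ext x
    simp only [Finset.mem_Ioc, Finset.mem_map, Finset.mem_range, he]
    constructor
    · rintro ⟨h1, h2⟩
      exact ⟨(j - x).toNat, by omega, by omega⟩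
    · rintro ⟨r, hr, rfl⟩
      omega
  unfold theta knotEsymm
  rw [hmap, Finset.powersetCard_map, Finset.sum_map]
  congr 1
  refine Finset.sum_congr rfl fun u _ => ?_
  simp [Finset.mapEmbedding_apply, he]

/-! ### Complete symmetric functions of consecutive knots -/

/-- The complete symmetric function of order `l` of `t j, …, t (j + n - 1)`. -/
noncomputable def knotHsymm (t : ℤ → ℝ) : ℕ → ℤ → ℕ → ℝ
  | _, _, 0 => 1
  | 0, _, _ + 1 => 0
  | n + 1, j, l + 1 => knotHsymm t n j (l + 1) + t (j + n) * knotHsymm t (n + 1) j l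

theorem knotHsymm_order_zero (t : ℤ → ℝ) (n : ℕ) (j : ℤ) : knotHsymm t n j 0 = 1 := by
  cases n <;> simp [knotHsymm]

theorem knotHsymm_succ (t : ℤ → ℝ) (n : ℕ) (j : ℤ) (l : ℕ) :
    knotHsymm t (n + 1) j (l + 1)
      = knotHsymm t n j (l + 1) + t (j + n) * knotHsymm t (n + 1) j l := by
  rw [knotHsymm]

/-- The defining recursion splits off the last knot; this one splits off the first. The symmetry is
not built into the definition and needs a double induction, on the number of knots and on the order.
-/
theorem knotHsymm_succ' (t : ℤ → ℝ) (n : ℕ) (j : ℤ) (l : ℕ) :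
    knotHsymm t (n + 1) j (l + 1)
      = knotHsymm t n (j + 1) (l + 1) + t j * knotHsymm t (n + 1) j l := by
  induction n generalizing l with
  | zero => simp [knotHsymm]
  | succ n ihn =>
    induction l with
    | zero =>
      have h1 := ihn 0
      have h2 := knotHsymm_succ t (n + 1) j 0
      have h3 := knotHsymm_succ t n (j + 1) 0
      simp only [knotHsymm_order_zero] at *
      rw [h2, h1, h3]
      push_cast
      rw [show j + 1 + (n : ℤ) = j + (n + 1) by ring]
      ring
    | succ l ihl =>
      have h1 := ihn (l + 1)
      have h2 := knotHsymm_succ t (n + 1) j (l + 1)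
      have h3 := knotHsymm_succ t n (j + 1) (l + 1)
      have h4 := knotHsymm_succ t (n + 1) j l
      push_cast at *
      rw [show j + 1 + (n : ℤ) = j + (n + 1) by ring] at h3
      linear_combination h2 + h1 - h3 + t (j + (n + 1)) * ihl - t j * h4

/-- Weighting the first-knot and last-knot recursions by the opposite end knots cancels their
lower-order terms. -/
theorem knotHsymm_cross (t : ℤ → ℝ) (n : ℕ) (j : ℤ) (l : ℕ) :
    t (j + n) * knotHsymm t n (j + 1) l - t j * knotHsymm t n j l
      = (t (j + n) - t j) * knotHsymm t (n + 1) j l := by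
  cases l with
  | zero => simp [knotHsymm_order_zero]
  | succ l =>
    linear_combination t j * knotHsymm_succ t n j l - t (j + n) * knotHsymm_succ' t n j l

theorem knotHsymm_one_knot (t : ℤ → ℝ) (j : ℤ) (l : ℕ) : knotHsymm t 1 j l = t j ^ l := by
  induction l with
  | zero => simp [knotHsymm]
  | succ l ih =>
    have h := knotHsymm_succ t 0 j l
    simp only [zero_add] at h
    rw [h, ih]
    simp [knotHsymm]
    ring

theorem knotHsymm_order_one (t : ℤ → ℝ) (n : ℕ) (j : ℤ) :
    knotHsymm t n j 1 = ∑ r ∈ Finset.Ioc (j - 1) (j - 1 + n), t r := by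
  induction n with
  | zero => simp [knotHsymm]
  | succ n ih =>
    have h : Finset.Ioc (j - 1) (j - 1 + ((n + 1 : ℕ) : ℤ))
        = insert (j + n : ℤ) (Finset.Ioc (j - 1) (j - 1 + n)) := by
      ext x; simp only [Finset.mem_Ioc, Finset.mem_insert]; push_cast; omega
    rw [h, Finset.sum_insert (by simp), ← ih, knotHsymm_succ, knotHsymm_order_zero]
    ring

theorem two_mul_knotHsymm_order_two (t : ℤ → ℝ) (n : ℕ) (j : ℤ) :
    2 * knotHsymm t n j 2 = (∑ r ∈ Finset.Ioc (j - 1) (j - 1 + n), t r) ^ 2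
      + ∑ r ∈ Finset.Ioc (j - 1) (j - 1 + n), t r ^ 2 := by
  induction n with
  | zero => simp [knotHsymm]
  | succ n ih =>
    have h : Finset.Ioc (j - 1) (j - 1 + ((n + 1 : ℕ) : ℤ))
        = insert (j + n : ℤ) (Finset.Ioc (j - 1) (j - 1 + n)) := by
      ext x; simp only [Finset.mem_Ioc, Finset.mem_insert]; push_cast; omega
    have h1 := knotHsymm_order_one t (n + 1) j
    rw [h, Finset.sum_insert (by simp)] at h1
    rw [h, Finset.sum_insert (by simp), Finset.sum_insert (by simp), knotHsymm_succ, h1]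
    linear_combination ih

/-! ### Basic properties of the Cox–de Boor splines -/

section coxDeBoor

variable {t : ℤ → ℝ}

theorem coxDeBoor_zero (t : ℤ → ℝ) (j : ℤ) (x : ℝ) :
    coxDeBoor t 0 j x = (Set.Ico (t j) (t (j + 1))).indicator (fun _ => 1) x := by
  rw [coxDeBoor]

theorem coxDeBoor_succ (t : ℤ → ℝ) (k : ℕ) (j : ℤ) (x : ℝ) :
    coxDeBoor t (k + 1) j x =
      (x - t j) / (t (j + k + 1) - t j) * coxDeBoor t k j x
        + (t (j + k + 2) - x) / (t (j + k + 2) - t (j + 1)) * coxDeBoor t k (j + 1) x := by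
  rw [coxDeBoor]

theorem coxDeBoor_eq_zero (ht : StrictMono t) (k : ℕ) (j : ℤ) {x : ℝ}
    (hx : x < t j ∨ t (j + k + 1) ≤ x) : coxDeBoor t k j x = 0 := by
  induction k generalizing j with
  | zero =>
    rw [coxDeBoor_zero, Set.indicator_of_notMem]
    rintro ⟨h1, h2⟩
    simp only [Nat.cast_zero, add_zero] at hx
    rcases hx with h | h <;> linarith
  | succ k ih =>
    push_cast at hx
    rw [coxDeBoor_succ, ih j, ih (j + 1)]
    · simp
    · rcases hx with h | h
      · exact Or.inl (h.trans (ht (by omega)))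
      · exact Or.inr (le_trans (ht.monotone (by omega)) h)
    · rcases hx with h | h
      · exact Or.inl h
      · exact Or.inr (le_trans (ht.monotone (by omega)) h)

theorem coxDeBoor_nonneg (ht : StrictMono t) (k : ℕ) (j : ℤ) (x : ℝ) :
    0 ≤ coxDeBoor t k j x := by
  induction k generalizing j with
  | zero =>
    rw [coxDeBoor_zero]
    exact Set.indicator_nonneg (fun _ _ => zero_le_one) x
  | succ k ih =>
    by_cases hx : x < t j ∨ t (j + (k + 1 : ℕ) + 1) ≤ x
    · rw [coxDeBoor_eq_zero ht _ _ hx]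
    · push Not at hx
      rw [coxDeBoor_succ]
      have h1 : t j < t (j + k + 1) := ht (by omega)
      have h2 : t (j + 1) < t (j + k + 2) := ht (by omega)
      have h3 : x < t (j + k + 2) := by
        have := hx.2
        rwa [show j + ((k + 1 : ℕ) : ℤ) + 1 = j + k + 2 by push_cast; ring] at this
      have := ih j
      have := ih (j + 1)
      have := hx.1
      refine add_nonneg (mul_nonneg (div_nonneg ?_ ?_) ?_) (mul_nonneg (div_nonneg ?_ ?_) ?_) <;>
        linarith

theorem IsPartition.exists_mem_Ico (ht : IsPartition t) (x : ℝ) :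
    ∃ i : ℤ, t i ≤ x ∧ x < t (i + 1) := by
  obtain ⟨b, hb⟩ := (ht.tendsto_atTop.eventually_gt_atTop x).exists
  obtain ⟨a, ha⟩ := (ht.tendsto_atBot.eventually_le_atBot x).exists
  obtain ⟨i, hi, hmax⟩ := Int.exists_greatest_of_bdd (P := fun z => t z ≤ x)
    ⟨b, fun z hz => (ht.strictMono.lt_iff_lt.1 (hz.trans_lt hb)).le⟩ ⟨a, ha⟩
  refine ⟨i, hi, lt_of_not_ge fun h => ?_⟩
  have := hmax _ h
  omega

theorem coxDeBoor_eq_zero_of_notMem (ht : StrictMono t) (k : ℕ) {i j : ℤ} {x : ℝ}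
    (h1 : t i ≤ x) (h2 : x < t (i + 1)) (hj : j ∉ Finset.Icc (i - k) i) :
    coxDeBoor t k j x = 0 := by
  apply coxDeBoor_eq_zero ht
  rw [Finset.mem_Icc] at hj
  by_cases h : i < j
  · exact Or.inl (h2.trans_le (ht.monotone (by omega)))
  · exact Or.inr (le_trans (ht.monotone (by omega)) h1)

/-- Allows the two terms of the Cox–de Boor recursion to be regrouped by lower-degree spline. -/
theorem hasSum_add_of_hasSum_add_shift {f g : ℤ → ℝ} {S : ℝ} (hf : Summable f)
    (h : HasSum (fun j => f j + g (j - 1)) S) : HasSum (fun j => f j + g j) S := by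
  have h1 : HasSum (fun j => g (j - 1)) (S - ∑' j, f j) := by
    simpa using h.sub hf.hasSum
  have h2 : HasSum g (S - ∑' j, f j) := (Equiv.subRight (1 : ℤ)).hasSum_iff.1 h1
  simpa using hf.hasSum.add h2

/-- Marsden's identity, in terms of the monomials. -/
theorem hasSum_knotEsymm_mul_coxDeBoor (ht : IsPartition t) (k l : ℕ) (x : ℝ) :
    HasSum (fun j => knotEsymm t (Finset.Ioc j (j + k)) l * coxDeBoor t k j x)
      (k.choose l * x ^ l) := by
  obtain ⟨i, hi1, hi2⟩ := ht.exists_mem_Ico x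
  induction k generalizing l with
  | zero =>
    cases l with
    | zero =>
      have h := hasSum_single (f := fun j => coxDeBoor t 0 j x) i fun j hj =>
        coxDeBoor_eq_zero_of_notMem ht.strictMono 0 hi1 hi2 (by simpa using hj)
      have h' : coxDeBoor t 0 i x = 1 := by
        rw [coxDeBoor_zero, Set.indicator_of_mem (Set.mem_Ico.2 ⟨hi1, hi2⟩)]
      simp only [h'] at h
      simpa [knotEsymm] using h
    | succ l => simp [knotEsymm_empty_succ]
  | succ k ih =>
    -- The degree-`k` spline of index `j` occurs in the degree-`k + 1` splines of indices `j` and `j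
    -- - 1`; the bracket collects its two contributions.
    have key : ∀ (l : ℕ) (S : ℝ),
        HasSum (fun j => (knotEsymm t (Finset.Ioc j (j + (k + 1 : ℕ))) l
            * ((x - t j) / (t (j + k + 1) - t j))
          + knotEsymm t (Finset.Ioc (j - 1) (j - 1 + (k + 1 : ℕ))) l
            * ((t (j + k + 1) - x) / (t (j + k + 1) - t j))) * coxDeBoor t k j x) S →
        HasSum (fun j => knotEsymm t (Finset.Ioc j (j + (k + 1 : ℕ))) l
          * coxDeBoor t (k + 1) j x) S := by
      intro l S h
      have hs : Summable fun j => knotEsymm t (Finset.Ioc j (j + (k + 1 : ℕ))) l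
          * ((x - t j) / (t (j + k + 1) - t j)) * coxDeBoor t k j x :=
        summable_of_ne_finset_zero (s := Finset.Icc (i - k) i) fun j hj => by
          rw [coxDeBoor_eq_zero_of_notMem ht.strictMono k hi1 hi2 hj, mul_zero]
      have := hasSum_add_of_hasSum_add_shift (S := S) hs
        (g := fun j => knotEsymm t (Finset.Ioc j (j + (k + 1 : ℕ))) l
          * ((t (j + k + 2) - x) / (t (j + k + 2) - t (j + 1))) * coxDeBoor t k (j + 1) x) (by
          convert h using 2 with j
          rw [show j - 1 + (k : ℤ) + 2 = j + k + 1 by ring, sub_add_cancel]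
          ring)
      convert this using 2 with j
      rw [coxDeBoor_succ]
      ring
    apply key
    have hne : ∀ j : ℤ, t (j + k + 1) - t j ≠ 0 := fun j =>
      sub_ne_zero.2 (ht.strictMono (by omega : j < j + k + 1)).ne'
    cases l with
    | zero =>
      have := ih 0
      simp only [knotEsymm_zero, Nat.choose_zero_right] at *
      convert this using 2 with j
      have := hne j
      field_simp
      ring
    | succ l =>
      have h := (ih (l + 1)).add ((ih l).mul_left x)
      have hS : ((k + 1).choose (l + 1) : ℝ) * x ^ (l + 1)
          = k.choose (l + 1) * x ^ (l + 1) + x * (k.choose l * x ^ l) := by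
        rw [Nat.choose_succ_succ]; push_cast; ring
      rw [hS]
      convert h using 2 with j
      -- The two knot sets differ only in an end knot. The weights sum to one and average the two
      -- end knots to `x`, so the bracket equals `e_{l+1} + x e_l` of the common knots.
      have e1 : Finset.Ioc j (j + ((k + 1 : ℕ) : ℤ))
          = insert (j + k + 1) (Finset.Ioc j (j + k)) := by
        ext x; simp only [Finset.mem_Ioc, Finset.mem_insert]; push_cast; omega
      have e2 : Finset.Ioc (j - 1) (j - 1 + ((k + 1 : ℕ) : ℤ))
          = insert j (Finset.Ioc j (j + k)) := by
        ext x; simp only [Finset.mem_Ioc, Finset.mem_insert]; push_cast; omega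
      rw [e1, e2, knotEsymm_insert t (by simp), knotEsymm_insert t (by simp)]
      have := hne j
      field_simp
      ring

/-- The B-splines of degree `k` that do not vanish on a knot interval are linearly independent
there: the collocation matrix at `k + 1` points of the interval divides a Vandermonde matrix. -/
theorem eq_zero_of_hasSum_coxDeBoor_eq_zero (ht : IsPartition t) (k : ℕ) {c : ℤ → ℝ}
    (h : ∀ x, HasSum (fun j => c j * coxDeBoor t k j x) 0) (i : ℤ) : c i = 0 := by
  have hlt : t i < t (i + 1) := ht.strictMono (by omega)
  -- Dividing by `k + 1` rather than `k` keeps the last node strictly below `t (i + 1)`, as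
  -- half-open intervals require.
  set x : Fin (k + 1) → ℝ := fun r => t i + (t (i + 1) - t i) * ((r : ℝ) / (k + 1)) with hx
  have hx1 : ∀ r, t i ≤ x r := fun r => by
    have : 0 ≤ (t (i + 1) - t i) * ((r : ℝ) / (k + 1)) :=
      mul_nonneg (by linarith) (by positivity)
    simp only [hx]; linarith
  have hx2 : ∀ r, x r < t (i + 1) := fun r => by
    have hr : ((r : ℕ) : ℝ) < k + 1 := by exact_mod_cast r.2
    have : (r : ℝ) / (k + 1) < 1 := by rw [div_lt_one (by positivity)]; exact hr
    simp only [hx]; nlinarith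
  have hinj : Function.Injective x := fun r s hrs => by
    have h1 : (t (i + 1) - t i) * ((r : ℝ) / (k + 1))
        = (t (i + 1) - t i) * ((s : ℝ) / (k + 1)) := by simpa [hx] using hrs
    have h2 := mul_left_cancel₀ (sub_pos.2 hlt).ne' h1
    have h3 : (k : ℝ) + 1 ≠ 0 := by positivity
    rw [div_left_inj' h3] at h2
    exact Fin.ext (by exact_mod_cast h2)
  have hsum : ∀ (d : ℤ → ℝ) (S : ℝ) (r : Fin (k + 1)),
      HasSum (fun j => d j * coxDeBoor t k j (x r)) S →
      ∑ s : Fin (k + 1), coxDeBoor t k (i - k + (s : ℕ)) (x r) * d (i - k + (s : ℕ)) = S := by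
    intro d S r hd
    let e : Fin (k + 1) ↪ ℤ :=
      ⟨fun s => i - k + (s : ℕ), fun a b hab => Fin.ext (by simpa using hab)⟩
    have he : ∀ s, e s = i - k + (s : ℕ) := fun _ => rfl
    have h1 : HasSum (fun j => d j * coxDeBoor t k j (x r))
        (∑ j ∈ Finset.univ.map e, d j * coxDeBoor t k j (x r)) :=
      hasSum_sum_of_ne_finset_zero fun j hj => by
        rw [coxDeBoor_eq_zero_of_notMem ht.strictMono k (hx1 r) (hx2 r), mul_zero]
        intro hj'
        rw [Finset.mem_Icc] at hj'
        refine hj (Finset.mem_map.2 ⟨⟨(j - (i - k)).toNat, by omega⟩, Finset.mem_univ _, ?_⟩)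
        rw [he]
        simp only
        omega
    rw [← h1.unique hd, Finset.sum_map]
    exact Finset.sum_congr rfl fun s _ => mul_comm _ _
  let A : Matrix (Fin (k + 1)) (Fin (k + 1)) ℝ :=
    Matrix.of fun r s => coxDeBoor t k (i - k + (s : ℕ)) (x r)
  let E : Matrix (Fin (k + 1)) (Fin (k + 1)) ℝ :=
    Matrix.of fun s l => knotEsymm t (Finset.Ioc (i - k + (s : ℕ)) (i - k + (s : ℕ) + k)) l
      / k.choose l
  have hAE : A * E = Matrix.vandermonde x := by
    ext r l
    rw [Matrix.mul_apply, Matrix.vandermonde_apply]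
    refine hsum (fun j => knotEsymm t (Finset.Ioc j (j + k)) l / k.choose l) _ r ?_
    have hc : (k.choose l : ℝ) ≠ 0 := by
      exact_mod_cast (Nat.choose_pos (Nat.lt_succ_iff.1 l.2)).ne'
    have := (hasSum_knotEsymm_mul_coxDeBoor ht k l (x r)).div_const (k.choose l : ℝ)
    rw [mul_div_cancel_left₀ _ hc] at this
    simpa only [mul_div_right_comm] using this
  -- Only the product `A * E` is known to be nonsingular, as a Vandermonde matrix with distinct
  -- nodes; this already forces `A` to be so.
  have hdet : A.det ≠ 0 := by
    intro h0
    have := congrArg Matrix.det hAE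
    rw [Matrix.det_mul, h0, zero_mul] at this
    exact Matrix.det_vandermonde_ne_zero_iff.2 hinj this.symm
  have hv := Matrix.eq_zero_of_mulVec_eq_zero hdet
    (v := fun s : Fin (k + 1) => c (i - k + (s : ℕ))) (by
      ext r
      exact hsum c 0 r (h (x r)))
  have := congrFun hv (Fin.last k)
  simpa using this

/-! ### Moments -/

/-- Induction on the degree for all orders at once, since the factor `x` in the Cox–de Boor
recursion raises the order by one. Integrability is carried along so that the integral splits. -/
theorem integral_pow_mul_coxDeBoor (ht : StrictMono t) (k : ℕ) (j : ℤ) (l : ℕ) :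
    Integrable (fun x => x ^ l * coxDeBoor t k j x) ∧
    ∫ x, x ^ l * coxDeBoor t k j x
      = (t (j + k + 1) - t j) / (k + 1) * (knotHsymm t (k + 2) j l / (k + 1 + l).choose l) := by
  induction k generalizing j l with
  | zero =>
    have hlt : t j < t (j + 1) := ht (by omega)
    have h0 : (fun x => x ^ l * coxDeBoor t 0 j x)
        = (Set.Ico (t j) (t (j + 1))).indicator fun x => x ^ l := by
      ext x
      rw [coxDeBoor_zero]
      by_cases hx : x ∈ Set.Ico (t j) (t (j + 1)) <;> simp [hx]
    rw [h0]
    constructor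
    · rw [integrable_indicator_iff measurableSet_Ico]
      exact ((continuous_pow l).continuousOn.integrableOn_compact isCompact_Icc).mono_set
        Set.Ico_subset_Icc_self
    · rw [integral_indicator measurableSet_Ico, integral_Ico_eq_integral_Ioc,
        ← intervalIntegral.integral_of_le hlt.le, integral_pow]
      have h1 := knotHsymm_succ t 1 j l
      have h2 := knotHsymm_succ' t 1 j l
      simp only [knotHsymm_one_knot, Nat.cast_one] at h1 h2
      have h3 : ((0 + 1 + l).choose l : ℝ) = l + 1 := by
        rw [show 0 + 1 + l = l + 1 by ring, Nat.choose_succ_self_right]; push_cast; ring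
      rw [h3]
      have h4 : (l : ℝ) + 1 ≠ 0 := by positivity
      simp only [Nat.cast_zero, add_zero, zero_add] at *
      field_simp
      linear_combination h1 - h2
  | succ k ih =>
    have hn1 : t (j + k + 1) - t j ≠ 0 :=
      sub_ne_zero.2 (ht (by omega : j < j + k + 1)).ne'
    have hn2 : t (j + k + 2) - t (j + 1) ≠ 0 :=
      sub_ne_zero.2 (ht (by omega : j + 1 < j + k + 2)).ne'
    have hfun : (fun x => x ^ l * coxDeBoor t (k + 1) j x) = fun x =>
        (1 / (t (j + k + 1) - t j)) * (x ^ (l + 1) * coxDeBoor t k j x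
            - t j * (x ^ l * coxDeBoor t k j x))
          + (1 / (t (j + k + 2) - t (j + 1))) *
            (t (j + k + 2) * (x ^ l * coxDeBoor t k (j + 1) x)
              - x ^ (l + 1) * coxDeBoor t k (j + 1) x) := by
      ext x
      rw [coxDeBoor_succ]
      ring
    obtain ⟨i1, e1⟩ := ih j l
    obtain ⟨i2, e2⟩ := ih j (l + 1)
    obtain ⟨i3, e3⟩ := ih (j + 1) l
    obtain ⟨i4, e4⟩ := ih (j + 1) (l + 1)
    have j1 : Integrable fun x => (1 / (t (j + k + 1) - t j)) *
        (x ^ (l + 1) * coxDeBoor t k j x - t j * (x ^ l * coxDeBoor t k j x)) :=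
      (i2.sub (i1.const_mul (t j))).const_mul _
    have j2 : Integrable fun x => (1 / (t (j + k + 2) - t (j + 1))) *
        (t (j + k + 2) * (x ^ l * coxDeBoor t k (j + 1) x)
          - x ^ (l + 1) * coxDeBoor t k (j + 1) x) :=
      ((i3.const_mul (t (j + k + 2))).sub i4).const_mul _
    rw [hfun]
    refine ⟨j1.add j2, ?_⟩
    rw [integral_add j1 j2, integral_const_mul, integral_const_mul,
      integral_sub i2 (i1.const_mul _), integral_sub (i3.const_mul _) i4,
      integral_const_mul, integral_const_mul, e1, e2, e3, e4]
    have s1 := knotHsymm_succ t (k + 2) j l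
    have s2 := knotHsymm_succ' t (k + 2) j l
    have c1 : (((k + 1 + (l + 1)).choose (l + 1) : ℕ) : ℝ) * (l + 1)
        = (k + 1 + l).choose l * (k + 1 + l + 1) := by
      have := Nat.add_one_mul_choose_eq (k + 1 + l) l
      rw [show k + 1 + (l + 1) = k + 1 + l + 1 by ring]
      have h' : (((k + 1 + l + 1) * (k + 1 + l).choose l : ℕ) : ℝ)
        = (((k + 1 + l + 1).choose (l + 1) * (l + 1) : ℕ) : ℝ) := by exact_mod_cast this
      push_cast at h'
      linarith
    have c2 : (((k + 1 + 1 + l).choose l : ℕ) : ℝ) * (k + 2)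
        = (k + 1 + l).choose l * (k + 1 + l + 1) := by
      have := Nat.choose_mul_succ_eq (k + 1 + l) l
      rw [show k + 1 + l + 1 - l = k + 2 by omega] at this
      rw [show k + 1 + 1 + l = k + 1 + l + 1 by ring]
      have h' : (((k + 1 + l).choose l * (k + 1 + l + 1) : ℕ) : ℝ)
        = (((k + 1 + l + 1).choose l * (k + 2) : ℕ) : ℝ) := by exact_mod_cast this
      push_cast at h'
      linarith
    have hc : (0 : ℝ) < (k + 1 + l).choose l := by
      exact_mod_cast Nat.choose_pos (by omega)
    have c1' : (((k + 1 + (l + 1)).choose (l + 1) : ℕ) : ℝ)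
        = (k + 1 + l).choose l * (k + 1 + l + 1) / (l + 1) := by
      rw [eq_div_iff (by positivity)]; exact c1
    have c2' : (((k + 1 + 1 + l).choose l : ℕ) : ℝ)
        = (k + 1 + l).choose l * (k + 1 + l + 1) / (k + 2) := by
      rw [eq_div_iff (by positivity)]; exact c2
    rw [c1', c2']
    have a1 : j + 1 + (k : ℤ) + 1 = j + k + 2 := by ring
    have a2 : j + (((k + 1 : ℕ) : ℤ)) + 1 = j + k + 2 := by push_cast; ring
    have a3 : j + (((k + 2 : ℕ) : ℤ)) = j + k + 2 := by push_cast; ring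
    have s3 := knotHsymm_cross t (k + 2) j l
    rw [a3] at s1 s3
    rw [a1, a2, show k + 1 + 2 = k + 2 + 1 by ring]
    -- After substituting `s4`, the only relation still needed among the symmetric functions is
    -- `s5`.
    have s4 : knotHsymm t (k + 2) j (l + 1) = knotHsymm t (k + 2) (j + 1) (l + 1)
        + (t j - t (j + k + 2)) * knotHsymm t (k + 2 + 1) j l := by
      linear_combination s2 - s1
    have s5 : t (j + k + 2) * knotHsymm t (k + 2) (j + 1) l = t j * knotHsymm t (k + 2) j l
        + (t (j + k + 2) - t j) * knotHsymm t (k + 2 + 1) j l := by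
      linear_combination s3
    rw [s4]
    push_cast
    generalize knotHsymm t (k + 2) (j + 1) (l + 1) = Y' at *
    generalize knotHsymm t (k + 2) (j + 1) l = Y at *
    generalize knotHsymm t (k + 2) j l = X at *
    generalize knotHsymm t (k + 2 + 1) j l = Z at *
    generalize ((k + 1 + l).choose l : ℝ) = c at *
    field_simp
    linear_combination (k + 1 + l + 1) * (k + 2) * s5

theorem integrable_coxDeBoor (ht : StrictMono t) (k : ℕ) (j : ℤ) :
    Integrable (coxDeBoor t k j) := by
  simpa using (integral_pow_mul_coxDeBoor ht k j 0).1

theorem integral_coxDeBoor (ht : StrictMono t) (k : ℕ) (j : ℤ) :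
    ∫ x, coxDeBoor t k j x = (t (j + k + 1) - t j) / (k + 1) := by
  simpa [knotHsymm_order_zero] using (integral_pow_mul_coxDeBoor ht k j 0).2

theorem integral_coxDeBoor_pos (ht : StrictMono t) (k : ℕ) (j : ℤ) :
    0 < ∫ x, coxDeBoor t k j x := by
  rw [integral_coxDeBoor ht]
  exact div_pos (sub_pos.2 (ht (by omega))) (by positivity)

end coxDeBoor

/-! ### The averaging functionals -/

section mean

variable {t : ℤ → ℝ} {m : ℕ}

theorem mSpline_nonneg (ht : StrictMono t) (m : ℕ) (j : ℤ) (x : ℝ) : 0 ≤ mSpline t m j x :=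
  div_nonneg (coxDeBoor_nonneg ht _ _ _) (integral_coxDeBoor_pos ht _ _).le

theorem integrable_mSpline (ht : StrictMono t) (m : ℕ) (j : ℤ) : Integrable (mSpline t m j) :=
  (integrable_coxDeBoor ht _ _).div_const _

theorem integral_mSpline (ht : StrictMono t) (m : ℕ) (j : ℤ) : ∫ x, mSpline t m j x = 1 := by
  unfold mSpline
  rw [integral_div, div_self (integral_coxDeBoor_pos ht _ _).ne']

theorem integrable_pow_mul_mSpline (ht : StrictMono t) (m : ℕ) (j : ℤ) (l : ℕ) :
    Integrable fun x => x ^ l * mSpline t m j x := by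
  have := (integral_pow_mul_coxDeBoor ht (m - 2) (j - m + 1) l).1.div_const
    (∫ y, coxDeBoor t (m - 2) (j - m + 1) y)
  simpa only [mSpline, mul_div_assoc] using this

theorem moment_eq (ht : StrictMono t) (hm : 2 ≤ m) (j : ℤ) (l : ℕ) :
    moment t m j l = knotHsymm t m (j - m + 1) l / (m - 1 + l).choose l := by
  have hpos := integral_coxDeBoor_pos ht (m - 2) (j - m + 1)
  unfold moment mSpline
  simp only [← mul_div_assoc]
  rw [integral_div, (integral_pow_mul_coxDeBoor ht _ _ _).2, ← integral_coxDeBoor ht,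
    mul_div_cancel_left₀ _ hpos.ne', Nat.sub_add_cancel hm, show m - 2 + 1 = m - 1 by omega]

theorem abs_mean_le_one (ht : StrictMono t) (m : ℕ) (j : ℤ) {f : ℝ → ℝ}
    (hf : ∀ᵐ x, |f x| ≤ 1) : |mean t m j f| ≤ 1 := by
  rw [← integral_mSpline ht m j, ← Real.norm_eq_abs, mean]
  refine norm_integral_le_of_norm_le (integrable_mSpline ht m j) ?_
  filter_upwards [hf] with x hx
  rw [norm_mul, Real.norm_of_nonneg (mSpline_nonneg ht m j x)]
  exact mul_le_of_le_one_right (mSpline_nonneg ht m j x) hx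

theorem knotHsymm_order_one' (t : ℤ → ℝ) (m : ℕ) (j : ℤ) :
    knotHsymm t m (j - m + 1) 1 = ∑ r ∈ Finset.Ioc (j - m) j, t r := by
  rw [knotHsymm_order_one]
  congr 2 <;> ring

theorem two_mul_knotHsymm_order_two' (t : ℤ → ℝ) (m : ℕ) (j : ℤ) :
    2 * knotHsymm t m (j - m + 1) 2 = (∑ r ∈ Finset.Ioc (j - m) j, t r) ^ 2
      + ∑ r ∈ Finset.Ioc (j - m) j, t r ^ 2 := by
  rw [two_mul_knotHsymm_order_two, show j - (m : ℤ) + 1 - 1 = j - m by ring, sub_add_cancel]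

theorem theta_one (t : ℤ → ℝ) (m : ℕ) (j : ℤ) :
    theta t m j 1 = (∑ r ∈ Finset.Ioc (j - m) j, t r) / m := by
  rw [theta_eq, knotEsymm_one, Nat.choose_one_right]

theorem moment_one (ht : StrictMono t) (hm : 2 ≤ m) (j : ℤ) :
    moment t m j 1 = theta t m j 1 := by
  rw [moment_eq ht hm, theta_one, knotHsymm_order_one', Nat.sub_add_cancel (by omega),
    Nat.choose_one_right]

/-- The sum of the squared deviations of the knots `t (j - m + 1), …, t j` from their mean. -/
noncomputable def knotSpread (t : ℤ → ℝ) (m : ℕ) (j : ℤ) : ℝ :=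
  ∑ r ∈ Finset.Ioc (j - m) j, (t r - theta t m j 1) ^ 2

theorem knotSpread_nonneg (t : ℤ → ℝ) (m : ℕ) (j : ℤ) : 0 ≤ knotSpread t m j :=
  Finset.sum_nonneg fun _ _ => sq_nonneg _

theorem sum_knots (hm : 2 ≤ m) (j : ℤ) :
    ∑ r ∈ Finset.Ioc (j - m) j, t r = m * theta t m j 1 := by
  have : (m : ℝ) ≠ 0 := by positivity
  rw [theta_one]
  field_simp

theorem sum_sq_knots (hm : 2 ≤ m) (j : ℤ) :
    ∑ r ∈ Finset.Ioc (j - m) j, t r ^ 2 = knotSpread t m j + m * theta t m j 1 ^ 2 := by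
  have h : knotSpread t m j = ∑ r ∈ Finset.Ioc (j - (m : ℤ)) j,
      (t r ^ 2 - 2 * theta t m j 1 * t r + theta t m j 1 ^ 2) :=
    Finset.sum_congr rfl fun r _ => by ring
  rw [h, Finset.sum_add_distrib, Finset.sum_sub_distrib, ← Finset.mul_sum, sum_knots (t := t) hm]
  simp
  ring

/-- Newton's identity `2 e₂ = p₁² - p₂` with the power sums written through mean and spread. In
`moment_two` the sign of `p₂` is reversed, which is why the spread enters there with a plus. -/
theorem theta_two (t : ℤ → ℝ) (hm : 2 ≤ m) (j : ℤ) :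
    theta t m j 2 = theta t m j 1 ^ 2 - knotSpread t m j / (m * (m - 1)) := by
  have h := two_mul_knotEsymm_two t (Finset.Ioc (j - (m : ℤ)) j)
  rw [sum_knots (t := t) hm, sum_sq_knots (t := t) hm] at h
  have hm' : (2 : ℝ) ≤ m := by exact_mod_cast hm
  have h1 : (m : ℝ) ≠ 0 := by positivity
  have h2 : (m : ℝ) - 1 ≠ 0 := by linarith
  rw [theta_eq t m j 2, Nat.cast_choose_two]
  field_simp
  linear_combination h

theorem moment_two (ht : StrictMono t) (hm : 2 ≤ m) (j : ℤ) :
    moment t m j 2 = theta t m j 1 ^ 2 + knotSpread t m j / (m * (m + 1)) := by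
  have h := two_mul_knotHsymm_order_two' t m j
  rw [sum_knots (t := t) hm, sum_sq_knots (t := t) hm] at h
  have h1 : (m : ℝ) ≠ 0 := by positivity
  have h2 : (m : ℝ) + 1 ≠ 0 := by positivity
  rw [moment_eq ht hm, show m - 1 + 2 = m + 1 by omega, Nat.cast_choose_two]
  push_cast
  rw [add_sub_cancel_right]
  field_simp
  linear_combination h

/-- The Bhatia–Davis variance bound: sum `(t j - t r) * (t r - t (j - m + 1)) ≥ 0` over the knots.
-/
theorem knotSpread_le (ht : StrictMono t) (hm : 2 ≤ m) (j : ℤ) :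
    knotSpread t m j
      ≤ m * ((t j - theta t m j 1) * (theta t m j 1 - t (j - m + 1))) := by
  have h : 0 ≤ ∑ r ∈ Finset.Ioc (j - (m : ℤ)) j, (t j - t r) * (t r - t (j - m + 1)) := by
    refine Finset.sum_nonneg fun r hr => ?_
    rw [Finset.mem_Ioc] at hr
    exact mul_nonneg (sub_nonneg.2 (ht.monotone (by omega)))
      (sub_nonneg.2 (ht.monotone (by omega)))
  have h' : ∀ r, (t j - t r) * (t r - t (j - m + 1))
      = (t j + t (j - m + 1)) * t r - t r ^ 2 - t j * t (j - m + 1) := fun r => by ring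
  simp only [h'] at h
  rw [Finset.sum_sub_distrib, Finset.sum_sub_distrib, ← Finset.mul_sum, sum_knots (t := t) hm,
    sum_sq_knots (t := t) hm] at h
  simp at h
  linarith

theorem theta_one_le (ht : StrictMono t) (hm : 2 ≤ m) (j : ℤ) : theta t m j 1 ≤ t j := by
  have h : ∑ r ∈ Finset.Ioc (j - (m : ℤ)) j, t r ≤ ∑ r ∈ Finset.Ioc (j - (m : ℤ)) j, t j :=
    Finset.sum_le_sum fun r hr => ht.monotone (Finset.mem_Ioc.1 hr).2
  rw [sum_knots (t := t) hm] at h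
  simp at h
  exact le_of_mul_le_mul_left h (by positivity)

theorem le_theta_one (ht : StrictMono t) (hm : 2 ≤ m) (j : ℤ) :
    t (j - m + 1) ≤ theta t m j 1 := by
  have h : ∑ r ∈ Finset.Ioc (j - (m : ℤ)) j, t (j - m + 1)
      ≤ ∑ r ∈ Finset.Ioc (j - (m : ℤ)) j, t r :=
    Finset.sum_le_sum fun r hr => ht.monotone (by have := Finset.mem_Ioc.1 hr; omega)
  rw [sum_knots (t := t) hm] at h
  simp at h
  exact le_of_mul_le_mul_left h (by positivity)

theorem mean_quadratic (ht : StrictMono t) (hm : 2 ≤ m) (j : ℤ) (c₀ c₁ c₂ : ℝ) :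
    mean t m j (fun x => c₀ + c₁ * x + c₂ * x ^ 2)
      = c₀ + c₁ * theta t m j 1 + c₂ * moment t m j 2 := by
  have h0 := (integrable_pow_mul_mSpline ht m j 0).const_mul c₀
  have h1 := (integrable_pow_mul_mSpline ht m j 1).const_mul c₁
  have h2 := (integrable_pow_mul_mSpline ht m j 2).const_mul c₂
  have hfun : ∀ x : ℝ, mSpline t m j x * (c₀ + c₁ * x + c₂ * x ^ 2)
      = c₀ * (x ^ 0 * mSpline t m j x) + c₁ * (x ^ 1 * mSpline t m j x)
        + c₂ * (x ^ 2 * mSpline t m j x) := fun x => by ring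
  unfold mean
  simp only [hfun]
  have h01 : Integrable fun x => c₀ * (x ^ 0 * mSpline t m j x)
      + c₁ * (x ^ 1 * mSpline t m j x) := h0.add h1
  rw [integral_add h01 h2, integral_add h0 h1, integral_const_mul, integral_const_mul,
    integral_const_mul, ← moment_one ht hm]
  simp only [pow_zero, one_mul, integral_mSpline ht, mul_one, moment]

end mean

/-! ### Exactness -/

section exactness

variable {t : ℤ → ℝ} {m : ℕ}

theorem hasSum_theta_mul_bSpline (ht : IsPartition t) {l : ℕ} (hl : l ≤ m) (x : ℝ) :
    HasSum (fun i => theta t m i l * bSpline t m i x) (x ^ l) := by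
  have hc : (m.choose l : ℝ) ≠ 0 := by exact_mod_cast (Nat.choose_pos hl).ne'
  have h := (hasSum_knotEsymm_mul_coxDeBoor ht m l x).div_const (m.choose l : ℝ)
  rw [mul_div_cancel_left₀ _ hc] at h
  refine (congrArg (HasSum · (x ^ l)) (funext fun i => ?_)).mp
    ((Equiv.subRight (m : ℤ)).hasSum_iff.2 h)
  simp only [Function.comp, Equiv.subRight_apply, sub_add_cancel, theta_eq, bSpline]
  ring

theorem hasSum_bSpline (ht : IsPartition t) (m : ℕ) (x : ℝ) :
    HasSum (fun i => bSpline t m i x) 1 := by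
  simpa [theta_eq, knotEsymm_zero] using hasSum_theta_mul_bSpline ht (Nat.zero_le m) x

theorem summable_mul_bSpline (ht : IsPartition t) (m : ℕ) (c : ℤ → ℝ) (x : ℝ) :
    Summable fun i => c i * bSpline t m i x := by
  obtain ⟨i, h1, h2⟩ := ht.exists_mem_Ico x
  refine summable_of_ne_finset_zero (s := Finset.Icc i (i + m)) fun j hj => ?_
  rw [bSpline, coxDeBoor_eq_zero_of_notMem ht.strictMono m h1 h2, mul_zero]
  rw [Finset.mem_Icc] at *
  omega

theorem bSpline_coeff_unique (ht : IsPartition t) (m : ℕ) {c d : ℤ → ℝ}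
    (h : ∀ x, ∑' i, c i * bSpline t m i x = ∑' i, d i * bSpline t m i x) : c = d := by
  have h0 : ∀ x, HasSum (fun j => (c (j + m) - d (j + m)) * coxDeBoor t m j x) 0 := fun x => by
    have h1 := (summable_mul_bSpline ht m c x).hasSum.sub (summable_mul_bSpline ht m d x).hasSum
    rw [h x, sub_self] at h1
    refine (congrArg (HasSum · 0) (funext fun i => ?_)).mp
      ((Equiv.addRight (m : ℤ)).hasSum_iff.2 h1)
    simp [bSpline, sub_mul]
  ext i
  have := eq_zero_of_hasSum_coxDeBoor_eq_zero ht m (c := fun j => c (j + m) - d (j + m)) h0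
    (i - m)
  simp only [sub_add_cancel] at this
  linarith

theorem coeffFunctional_quadratic (ht : StrictMono t) (hm : 2 ≤ m) (p : ℕ) (a : Fin 3 → ℝ)
    (i : ℤ) (c₀ c₁ c₂ : ℝ) :
    coeffFunctional t m p a i (fun x => c₀ + c₁ * x + c₂ * x ^ 2)
      = c₀ * (a 0 + a 1 + a 2)
        + c₁ * (theta t m (i - p) 1 * a 0 + theta t m i 1 * a 1 + theta t m (i + p) 1 * a 2)
        + c₂ * (moment t m (i - p) 2 * a 0 + moment t m i 2 * a 1
          + moment t m (i + p) 2 * a 2) := by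
  simp only [coeffFunctional, mean_quadratic ht hm]
  ring

theorem exactOnP2_iff (G : (ℝ → ℝ) → ℝ → ℝ) :
    ExactOnP2 G ↔ ∀ c₀ c₁ c₂ x : ℝ,
      G (fun y => c₀ + c₁ * y + c₂ * y ^ 2) x = c₀ + c₁ * x + c₂ * x ^ 2 := by
  open Polynomial in
  constructor
  · intro h c₀ c₁ c₂ x
    have := h (C c₂ * X ^ 2 + C c₁ * X + C c₀) degree_quadratic_le x
    simp only [eval_add, eval_mul, eval_C, eval_pow, eval_X] at this
    have hfun : (fun y : ℝ => c₀ + c₁ * y + c₂ * y ^ 2)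
        = fun y => c₂ * y ^ 2 + c₁ * y + c₀ := by ext y; ring
    rw [hfun, this]
    ring
  · intro h q hq x
    have hq' : ∀ y, q.eval y = q.coeff 0 + q.coeff 1 * y + q.coeff 2 * y ^ 2 := fun y => by
      rw [eval_eq_sum_range' (n := 3) (by
        have := natDegree_le_of_degree_le (n := 2) (by exact_mod_cast hq)
        omega)]
      simp [Finset.sum_range_succ]
    simp only [hq', h]

/-- Both sides of `G q = q` are B-spline series, the right one by Marsden's identity, so
coefficients can be compared. Here `2 ≤ m` puts `x ^ 2` in the range of that identity. -/
theorem exactOnP2_integralQI_iff (ht : IsPartition t) (hm : 2 ≤ m) (p : ℕ)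
    (a : ℤ → Fin 3 → ℝ) :
    ExactOnP2 (integralQI t m p a) ↔ ∀ i, CoeffSystem t m p i (a i) := by
  have hθ : ∀ i, theta t m i 0 = 1 := fun i => by simp [theta_eq, knotEsymm_zero]
  rw [exactOnP2_iff]
  constructor
  · intro h
    have key : ∀ (l : ℕ) (hl : l ≤ m) (c₀ c₁ c₂ : ℝ),
        (∀ x : ℝ, c₀ + c₁ * x + c₂ * x ^ 2 = x ^ l) → ∀ i,
        coeffFunctional t m p (a i) i (fun x => c₀ + c₁ * x + c₂ * x ^ 2) = theta t m i l := by
      intro l hl c₀ c₁ c₂ hc i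
      refine congrFun (bSpline_coeff_unique ht m (c := fun i => coeffFunctional t m p (a i) i
        (fun x => c₀ + c₁ * x + c₂ * x ^ 2)) (d := fun i => theta t m i l) fun x => ?_) i
      rw [(hasSum_theta_mul_bSpline ht hl x).tsum_eq, ← hc]
      exact h c₀ c₁ c₂ x
    intro i
    have h0 := key 0 (by omega) 1 0 0 (by simp) i
    have h1 := key 1 (by omega) 0 1 0 (by simp) i
    have h2 := key 2 hm 0 0 1 (by simp) i
    rw [coeffFunctional_quadratic ht.strictMono hm] at h0 h1 h2
    rw [hθ] at h0
    exact ⟨by linarith, by linarith, by linarith⟩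
  · intro h c₀ c₁ c₂ x
    unfold integralQI
    have hs := (((hasSum_theta_mul_bSpline ht (Nat.zero_le m) x).mul_left c₀).add
      ((hasSum_theta_mul_bSpline ht (by omega : 1 ≤ m) x).mul_left c₁)).add
      ((hasSum_theta_mul_bSpline ht hm x).mul_left c₂)
    rw [pow_zero, mul_one, pow_one] at hs
    rw [← hs.tsum_eq]
    refine tsum_congr fun i => ?_
    obtain ⟨h0, h1, h2⟩ := h i
    rw [coeffFunctional_quadratic ht.strictMono hm, h0, h1, h2, hθ]
    ring

end exactness

/-! ### Solution of the linear system and norm estimate -/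

/-- The system for three masses `b 0, b 1, b 2` of total mass one located around
`θ - u`, `θ`, `θ + w`, with spreads `v₀, v, v₂`, and with barycentre `θ`. -/
theorem exists_unique_masses {θ u w v₀ v v₂ κ K : ℝ} (hu : 0 < u) (hw : 0 < w) (h₀ : 0 ≤ v₀)
    (h₂ : 0 ≤ v₂) (hv : v < u * w) (hκ : 0 ≤ κ + v) (hK : 2 * (κ + v) ≤ K * (u * w - v)) :
    ∃ a : Fin 3 → ℝ, (∀ b : Fin 3 → ℝ,
      (b 0 + b 1 + b 2 = 1 ∧ (θ - u) * b 0 + θ * b 1 + (θ + w) * b 2 = θ ∧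
        ((θ - u) ^ 2 + v₀) * b 0 + (θ ^ 2 + v) * b 1 + ((θ + w) ^ 2 + v₂) * b 2 = θ ^ 2 - κ)
        ↔ b = a) ∧ |a 0| + |a 1| + |a 2| ≤ 1 + K := by
  -- `D` is the determinant of the system.
  set D := (u + w) * (u * w - v) + w * v₀ + u * v₂ with hD
  have hpos : 0 < (u + w) * (u * w - v) := mul_pos (by linarith) (by linarith)
  have hDle : (u + w) * (u * w - v) ≤ D := by
    have := mul_nonneg hw.le h₀
    have := mul_nonneg hu.le h₂
    linarith
  have hDpos : 0 < D := hpos.trans_le hDle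
  have hq : 0 ≤ (κ + v) / D := div_nonneg hκ hDpos.le
  -- The barycentre condition forces the outer masses to be proportional to `w` and `u`; the second
  -- moment fixes the factor. Both being nonpositive, the absolute sum is `1 + 2 (κ + v) (u + w) /
  -- D`.
  refine ⟨![-((κ + v) / D * w), 1 + (κ + v) / D * (u + w), -((κ + v) / D * u)],
    fun b => ⟨?_, ?_⟩, ?_⟩
  · rintro ⟨e1, e2, e3⟩
    have f1 : w * b 2 = u * b 0 := by linear_combination e2 - θ * e1
    have f2 : b 0 * D = -((κ + v) * w) := by
      rw [hD]
      linear_combination w * (e3 - 2 * θ * e2 + (θ ^ 2 - v) * e1) - (w ^ 2 + v₂ - v) * f1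
    have f3 : b 2 * D = -((κ + v) * u) := by
      rw [hD]
      linear_combination u * (e3 - 2 * θ * e2 + (θ ^ 2 - v) * e1) + (u ^ 2 + v₀ - v) * f1
    have g0 : b 0 = -((κ + v) / D * w) := by
      field_simp
      linear_combination f2
    have g2 : b 2 = -((κ + v) / D * u) := by
      field_simp
      linear_combination f3
    ext s
    fin_cases s
    · exact g0
    · change b 1 = 1 + (κ + v) / D * (u + w)
      linarith
    · exact g2
  · rintro rfl
    have hq' : (κ + v) / D * D = κ + v := div_mul_cancel₀ _ hDpos.ne'
    simp only [Matrix.cons_val_zero, Matrix.cons_val_one, Matrix.cons_val]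
    refine ⟨by ring, by ring, ?_⟩
    rw [hD] at hq' ⊢
    linear_combination -hq'
  · simp only [Matrix.cons_val_zero, Matrix.cons_val_one, Matrix.cons_val]
    rw [abs_neg, abs_neg, abs_of_nonneg (mul_nonneg hq hw.le),
      abs_of_nonneg (mul_nonneg hq hu.le),
      abs_of_nonneg (add_nonneg zero_le_one (mul_nonneg hq (by linarith)))]
    have hK0 : 0 ≤ K := by
      by_contra! hneg
      nlinarith
    -- The outer spreads `v₀, v₂` only enlarge `D` and may be dropped.
    have : 2 * ((κ + v) / D * (u + w)) ≤ K := by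
      rw [div_mul_eq_mul_div, ← mul_div_assoc, div_le_iff₀ hDpos]
      calc 2 * ((κ + v) * (u + w)) = (u + w) * (2 * (κ + v)) := by ring
        _ ≤ (u + w) * (K * (u * w - v)) := by gcongr
        _ = K * ((u + w) * (u * w - v)) := by ring
        _ ≤ K * D := by gcongr
    linarith

theorem exists_unique_coeffSystem {t : ℤ → ℝ} {m p : ℕ} (ht : StrictMono t) (hm : 2 ≤ m)
    (hp : m ≤ p) (i : ℤ) :
    ∃ a : Fin 3 → ℝ, (∀ b, CoeffSystem t m p i b ↔ b = a) ∧
      |a 0| + |a 1| + |a 2| ≤ 1 + 4 / ((m : ℝ) - 1) := by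
  have hm' : (2 : ℝ) ≤ m := by exact_mod_cast hm
  have hm1 : (0 : ℝ) < (m : ℝ) - 1 := by linarith
  -- Here and in `l4` the hypothesis `m ≤ p` enters: neighbouring knot groups are disjoint.
  have l1 : theta t m (i - p) 1 < t (i - m + 1) :=
    (theta_one_le ht hm (i - p)).trans_lt (ht (by omega))
  have l2 := le_theta_one ht hm i
  have l3 := theta_one_le ht hm i
  have l4 : t i < theta t m (i + p) 1 :=
    (ht (by omega : i < i + p - m + 1)).trans_le (le_theta_one ht hm (i + p))
  have hP := knotSpread_le ht hm i
  have hP0 := knotSpread_nonneg t m i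
  set u := theta t m i 1 - theta t m (i - p) 1 with hu
  set w := theta t m (i + p) 1 - theta t m i 1 with hw
  have hlt : (t i - theta t m i 1) * (theta t m i 1 - t (i - m + 1)) < u * w := by
    rw [mul_comm u w]
    exact mul_lt_mul'' (by linarith) (by linarith) (by linarith) (by linarith)
  have hPlt : knotSpread t m i < m * (u * w) :=
    hP.trans_lt (mul_lt_mul_of_pos_left hlt (by linarith))
  have hv : knotSpread t m i / (m * (m + 1)) < u * w := by
    rw [div_lt_iff₀ (by positivity)]
    have : 0 < u * w := mul_pos (by linarith) (by linarith)
    nlinarith [mul_pos (by positivity : (0 : ℝ) < m * m) this]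
  obtain ⟨a, ha, hle⟩ := exists_unique_masses (θ := theta t m i 1) (u := u) (w := w)
    (v₀ := knotSpread t m (i - p) / (m * (m + 1))) (v := knotSpread t m i / (m * (m + 1)))
    (v₂ := knotSpread t m (i + p) / (m * (m + 1))) (κ := knotSpread t m i / (m * (m - 1)))
    (K := 4 / ((m : ℝ) - 1)) (by linarith) (by linarith)
    (div_nonneg (knotSpread_nonneg _ _ _) (by positivity))
    (div_nonneg (knotSpread_nonneg _ _ _) (by positivity)) hv
    (add_nonneg (div_nonneg hP0 (by positivity)) (div_nonneg hP0 (by positivity))) (by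
      -- The constant `4/(m-1)` is the one for which the required inequality becomes exactly a
      -- positive multiple of `V ≤ m u w`.
      have h1 : 4 / ((m : ℝ) - 1) * (u * w - knotSpread t m i / (m * (m + 1)))
          - 2 * (knotSpread t m i / (m * (m - 1)) + knotSpread t m i / (m * (m + 1)))
          = 4 / (m * (m - 1)) * (m * (u * w) - knotSpread t m i) := by
        have := hm1.ne'
        have : (m : ℝ) ≠ 0 := by positivity
        field_simp
        ring
      have : 0 ≤ 4 / ((m : ℝ) * (m - 1)) * (m * (u * w) - knotSpread t m i) :=
        mul_nonneg (by positivity) (by linarith)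
      linarith)
  refine ⟨a, fun b => ?_, hle⟩
  rw [← ha b, CoeffSystem, moment_two ht hm, moment_two ht hm, moment_two ht hm,
    theta_two t hm, hu, hw, sub_sub_cancel, add_sub_cancel]

/-- Clearing denominators leaves `16 (m - 1) ≤ m² (m + 2)` for even `m` and `16 ≤ (m + 1)²` for odd
`m`, with equality at `m = 2` and `m = 3`. -/
theorem four_div_le_boundConst {m : ℕ} (hm : 2 ≤ m) :
    4 / ((m : ℝ) - 1) ≤ boundConst m / 4 := by
  have hm' : (2 : ℝ) ≤ m := by exact_mod_cast hm
  have hm1 : (0 : ℝ) < (m : ℝ) - 1 := by linarith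
  unfold boundConst
  split_ifs with h
  · rw [div_div, div_le_div_iff₀ hm1 (by positivity)]
    have : 16 * ((m : ℝ) - 1) ≤ (m : ℝ) ^ 2 * (m + 2) := by nlinarith [sq_nonneg ((m : ℝ) - 2)]
    nlinarith
  · have h3 : (3 : ℝ) ≤ m := by
      have : m ≠ 2 := by rintro rfl; exact h even_two
      exact_mod_cast (by omega : 3 ≤ m)
    rw [div_div, div_le_div_iff₀ hm1 (by positivity)]
    nlinarith

/-- The value at `x` is a convex combination of the coefficient functionals, and each average
against `M_j` has modulus at most one. Since `f` enters only through these averages, an almost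
everywhere bound on `f` suffices at every `x`. -/
theorem abs_integralQI_le {t : ℤ → ℝ} (ht : IsPartition t) (m p : ℕ) {a : ℤ → Fin 3 → ℝ}
    {K : ℝ} (ha : ∀ i, |a i 0| + |a i 1| + |a i 2| ≤ K) {f : ℝ → ℝ} (hf : ∀ᵐ x, |f x| ≤ 1)
    (x : ℝ) : |integralQI t m p a f x| ≤ K := by
  have hsum := (hasSum_bSpline ht m x).mul_left K
  rw [mul_one] at hsum
  rw [← Real.norm_eq_abs, integralQI]
  refine tsum_of_norm_bounded hsum fun i => ?_
  have hB : 0 ≤ bSpline t m i x := coxDeBoor_nonneg ht.strictMono _ _ _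
  have hmean : ∀ (c : ℝ) (j : ℤ), |c * mean t m j f| ≤ |c| := fun c j => by
    rw [abs_mul]
    exact mul_le_of_le_one_right (abs_nonneg c) (abs_mean_le_one ht.strictMono m j hf)
  rw [norm_mul, Real.norm_of_nonneg hB]
  refine mul_le_mul_of_nonneg_right ?_ hB
  refine (abs_add_three _ _ _).trans (le_trans ?_ (ha i))
  exact add_le_add (add_le_add (hmean _ _) (hmean _ _)) (hmean _ _)

theorem infNorm_integralQI_le {t : ℤ → ℝ} (ht : IsPartition t) (m p : ℕ) {a : ℤ → Fin 3 → ℝ}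
    {K : ℝ} (ha : ∀ i, |a i 0| + |a i 1| + |a i 2| ≤ K) :
    infNorm (integralQI t m p a) ≤ ENNReal.ofReal K := by
  refine iSup_le fun f => iSup_le fun _ => iSup_le fun hf => iSup_le fun x => ?_
  rw [eLpNorm_exponent_top] at hf
  have hf' : ∀ᵐ y, |f y| ≤ 1 := by
    filter_upwards [enorm_ae_le_eLpNormEssSup f volume] with y hy
    have := hy.trans hf
    rw [← ofReal_norm, ENNReal.ofReal_le_one] at this
    exact this
  rw [← ofReal_norm]
  exact ENNReal.ofReal_le_ofReal (abs_integralQI_le ht m p ha hf' x)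

end SplineQI

theorem theorem8 (m p : ℕ) (hm : 2 ≤ m) (hp : m ≤ p) (t : ℤ → ℝ)
    (ht : SplineQI.IsPartition t) :
    (∀ a : ℤ → Fin 3 → ℝ,
      SplineQI.ExactOnP2 (SplineQI.integralQI t m p a) ↔
        ∀ i : ℤ, SplineQI.CoeffSystem t m p i (a i)) ∧
    ∃ a : ℤ → Fin 3 → ℝ,
      (∀ i : ℤ, SplineQI.CoeffSystem t m p i (a i)) ∧
      (∀ i : ℤ, ∀ b : Fin 3 → ℝ, SplineQI.CoeffSystem t m p i b → b = a i) ∧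
      SplineQI.ExactOnP2 (SplineQI.integralQI t m p a) ∧
      SplineQI.infNorm (SplineQI.integralQI t m p a)
        ≤ ENNReal.ofReal (1 + SplineQI.boundConst m / 4) := by
  choose a ha hle using fun i => SplineQI.exists_unique_coeffSystem ht.strictMono hm hp i
  have hsys : ∀ i, SplineQI.CoeffSystem t m p i (a i) := fun i => (ha i (a i)).2 rfl
  refine ⟨SplineQI.exactOnP2_integralQI_iff ht hm p, a, hsys, fun i b hb => (ha i b).1 hb,
    (SplineQI.exactOnP2_integralQI_iff ht hm p a).2 hsys,
    SplineQI.infNorm_integralQI_le ht m p fun i => (hle i).trans ?_⟩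
  have := SplineQI.four_div_le_boundConst hm
  linarith
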